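/- Consider infinitely repeated two-player matrix games: in every stage Alice and Bob simultaneously choose actions from finite sets $A$ and $B$, and Alice receives $G(a,b)\in[0,1]$. Let $\mathcal H=\bigcup_{n\ge 0}(A\times B)^n$ be the set of finite histories. Strategies are behavioral, i.e. arbitrary maps $\pi:\mathcal H\to\Delta(A)$ for Alice and $\phi:\mathcal H\to\Delta(B)$ for Bob, where $\Delta(X)$ is the set of probability distributions on $X$. For $h\in\mathcal H$ let $$V_G(\pi,\phi\mid h)=\liminf_{s\to\infty}\mathrm E_{\pi,\phi}\Big[\frac1s\sum_{n=|h|+1}^{|h|+s}G(a_n,b_n)\;:\;h\Big]$$ be the value when play continues from $h$ with Alice following $\pi$ and Bob following $\phi$ (also for histories $h$ that have probability zero), and write $V_G(\pi,\phi)=V_G(\pi,\phi\mid\emptyset)$. For a finite nonempty set $E$ of strategies for Alice (the experts), the open-ended regret of $\pi$ against $\phi$ is $$\mathcal R^{\mathrm{oe}}_{G,E}(\pi,\phi)=\max_{e\in E}\,\inf_{h\in\mathcal H}V_G(e,\phi\mid h)-V_G(\pi,\phi).$$ A learning algorithm $\mathcal A$ assigns to a game $G$ and a set of experts $E$ a strategy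 $\mathcal A_{G,E}$ for Alice. **Corollary.** For every integer $N\ge 3$ there exist an $N\times N$ game $G$ (with payoffs in $[0,1]$) and a finite nonempty set of experts $E$ such that, for every learning algorithm $\mathcal A$ and every $\delta$ with $0<\delta<\frac{N-2}{N}$, there is a strategy $\phi$ for Bob with $$\mathcal R^{\mathrm{oe}}_{G,E}(\mathcal A_{G,E},\phi)\;\ge\;\frac12\Big[\frac{N-2}{N}-\delta\Big]^2 .$$ -/

import Mathlib

namespace RepeatedGame

noncomputable section

/-- The stage game of an infinitely repeated game with action sets `A` (Alice) and `B` (Bob):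
Alice's payoff matrix, with entries in `[0, 1]`. -/
structure Game (A B : Type) where
  payoff : A → B → ℝ
  payoff_mem : ∀ a b, payoff a b ∈ Set.Icc (0 : ℝ) 1

/-- Finite histories of play, the empty one included, in chronological order. -/
abbrev History (A B : Type) : Type := List (A × B)

/-- Behavioral strategies of Alice: a distribution over her actions for every finite history. -/
abbrev AliceStrategy (A B : Type) : Type := History A B → PMF A

/-- Behavioral strategies of Bob: a distribution over his actions for every finite history. -/
abbrev BobStrategy (A B : Type) : Type := History A B → PMF B

/-- A learning algorithm chooses a strategy for Alice knowing the game and the (finite) set of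
expert strategies. -/
abbrev LearningAlgorithm (A B : Type) : Type :=
  Game A B → Finset (AliceStrategy A B) → AliceStrategy A B

variable {A B : Type}

/-- The law of the history `s` stages after `h`, when the play continues from `h` (whether or not
`h` itself has positive probability) with Alice following `π` and Bob following `φ`.  In each stage
the two actions are drawn independently of each other given the history so far. -/
def playLaw (π : AliceStrategy A B) (φ : BobStrategy A B) (h : History A B) :
    ℕ → PMF (History A B)
  | 0 => PMF.pure h
  | s + 1 => (playLaw π φ h s).bind fun h' =>
      (π h').bind fun a => (φ h').map fun b => h' ++ [(a, b)]

/-- Alice's total payoff over the stages `m + 1, m + 2, …` of the history `h'`. -/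
def totalPayoffAfter (G : Game A B) (m : ℕ) (h' : History A B) : ℝ :=
  ((h'.drop m).map fun p => G.payoff p.1 p.2).sum

/-- `E_{π,φ}[(1/s) ∑_{n = |h|+1}^{|h|+s} G(a_n, b_n) : h]`, the conditional expected average payoff
over the `s` stages that follow the history `h`.  For finite action sets the law of play after `s`
stages is finitely supported, so the sum has only finitely many nonzero terms. -/
def expectedAverage (G : Game A B) (π : AliceStrategy A B) (φ : BobStrategy A B)
    (h : History A B) (s : ℕ) : ℝ :=
  ∑' h' : History A B,
    (playLaw π φ h s h').toReal * ((1 / (s : ℝ)) * totalPayoffAfter G h.length h')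

/-- The value `V_G(π, φ | h)`: the limit inferior of the conditional expected average payoffs,
all of which lie in `[0, 1]`. -/
def value (G : Game A B) (π : AliceStrategy A B) (φ : BobStrategy A B) (h : History A B) : ℝ :=
  Filter.liminf (fun s : ℕ => expectedAverage G π φ h s) Filter.atTop

/-- Alice's open-ended regret
`max_{e ∈ E} inf_{h} V_G(e, φ | h) - V_G(π, φ)`, the infimum being over all finite histories and
`V_G(π, φ)` being the value from the empty history. -/
def openEndedRegret (G : Game A B) (E : Finset (AliceStrategy A B)) (hE : E.Nonempty)
    (π : AliceStrategy A B) (φ : BobStrategy A B) : ℝ :=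
  E.sup' hE (fun e => ⨅ h : History A B, value G e φ h) - value G π φ []

end

end RepeatedGame

/-!
The stage game used has payoffs depending on Bob alone: one of his actions, `b₀`, always gives
Alice `0`, and another one, `b₁`, always gives her `1`. The experts are the constant strategies,
one for each action of Alice.

Fix Alice's strategy `π` and first let Bob play `b₀` for ever. Against this passive Bob, the
events "Alice plays only `a` from some stage on", for the different actions `a`, are disjoint, so
one of them has probability at most `1 / |A|` (`exists_action_streak_le` is a version of this
without infinite plays). Bob singles out such an `a` and plays `b₀` until, for some `n`, Alice has
played `a` on all stages of a long window `[n, T n)`; from then on he plays `b₁`. After any history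
the expert "always `a`" triggers this reward in finite time, hence has value `1` everywhere
(`value_constExpert`). On the other hand, until the reward sets in, Alice faces the passive Bob. If
the deadlines `T n` are so late that few plays survive the window `[n, T n)` without sticking to
`a` for ever after `n`, with errors summable in `n`, then a union bound shows that she ever gets
the reward with probability at most `1 / |A| + ε`. This bounds her value, and so her regret is at
least `1 - 1 / |A| - ε` (`exists_openEndedRegret_ge`).

For `|A| = N` and `ε = δ` this number is larger than `(N - 2) / N - δ`, which lies in `[0, 1]` and
so exceeds half of its square.
-/

namespace RepeatedGame

open MeasureTheory Filter Topology

/-! ### Probabilities and expectations under discrete laws -/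

section Discrete

variable {X : Type}

/-- The probability of `S` under `p`, as a real number. All sets are measurable, by the choice of
the discrete σ-algebra. -/
noncomputable def prob (p : PMF X) (S : Set X) : ℝ :=
  (@PMF.toMeasure X ⊤ p).real S

lemma prob_mono (p : PMF X) {S T : Set X} (h : ∀ x ∈ p.support, x ∈ S → x ∈ T) :
    prob p S ≤ prob p T := by
  let _ : MeasurableSpace X := ⊤
  refine ENNReal.toReal_mono (measure_ne_top _ _) (p.toMeasure_mono trivial ?_)
  exact fun x hx => h x hx.2 hx.1

lemma prob_le_one (p : PMF X) (S : Set X) : prob p S ≤ 1 := by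
  let _ : MeasurableSpace X := ⊤
  exact measureReal_le_one

lemma prob_nonneg (p : PMF X) (S : Set X) : 0 ≤ prob p S := ENNReal.toReal_nonneg

lemma sum_prob_le_one {ι : Type*} [Fintype ι] (p : PMF X) (S : ι → Set X)
    (hS : Pairwise (Function.onFun Disjoint S)) : ∑ i, prob p (S i) ≤ 1 := by
  let _ : MeasurableSpace X := ⊤
  exact (sum_measureReal_le_measureReal_univ (μ := p.toMeasure) (fun i _ => trivial)
    fun i _ j _ hij => hS hij).trans measureReal_le_one

lemma prob_map {Y : Type} (p : PMF X) (f : X → Y) (S : Set Y) :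
    prob (p.map f) S = prob p (f ⁻¹' S) := by
  let _ : MeasurableSpace X := ⊤
  let _ : MeasurableSpace Y := ⊤
  exact congrArg ENNReal.toReal (p.toMeasure_map_apply _ S (measurable_from_top) trivial)

/-- A union bound for sets `U` that are covered by `F` and the differences `A i \ F' i`, where
`F' i ⊆ A i` has almost full probability in `A i`. -/
lemma prob_le_add_sum {ι : Type*} (p : PMF X) (I : Finset ι) {U F : Set X} {A F' : ι → Set X}
    {ε : ι → ℝ} (hU : U ⊆ F ∪ ⋃ i ∈ I, A i \ F' i) (hF : ∀ i ∈ I, F' i ⊆ A i)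
    (hε : ∀ i ∈ I, prob p (A i) ≤ prob p (F' i) + ε i) :
    prob p U ≤ prob p F + ∑ i ∈ I, ε i := by
  let _ : MeasurableSpace X := ⊤
  calc prob p U ≤ p.toMeasure.real (F ∪ ⋃ i ∈ I, A i \ F' i) := measureReal_mono hU
    _ ≤ p.toMeasure.real F + p.toMeasure.real (⋃ i ∈ I, A i \ F' i) := measureReal_union_le _ _
    _ ≤ p.toMeasure.real F + ∑ i ∈ I, p.toMeasure.real (A i \ F' i) := by
        gcongr
        exact measureReal_biUnion_finset_le _ _
    _ ≤ prob p F + ∑ i ∈ I, ε i := by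
        refine add_le_add le_rfl (Finset.sum_le_sum fun i hi => ?_)
        rw [measureReal_sdiff (hF i hi) trivial]
        exact sub_le_iff_le_add'.2 (hε i hi)

/-- Laws that agree off `R` give `R` the same probability. -/
lemma prob_congr_compl {p q : PMF X} {R : Set X} (h : ∀ x, x ∉ R → p x = q x) :
    prob p R = prob q R := by
  let _ : MeasurableSpace X := ⊤
  have key : p.toMeasure.real Rᶜ = q.toMeasure.real Rᶜ := by
    refine congrArg ENNReal.toReal ?_
    rw [p.toMeasure_apply trivial, q.toMeasure_apply trivial]
    refine tsum_congr fun x => ?_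
    by_cases hx : x ∈ R <;> simp [hx, h]
  have hR : MeasurableSet R := trivial
  rw [probReal_compl_eq_one_sub hR, probReal_compl_eq_one_sub hR] at key
  exact sub_right_injective key

lemma bind_congr_support {Y : Type} (p : PMF X) {f g : X → PMF Y}
    (h : ∀ x ∈ p.support, f x = g x) : p.bind f = p.bind g := by
  refine PMF.ext fun y => ?_
  rw [PMF.bind_apply, PMF.bind_apply]
  refine tsum_congr fun x => ?_
  by_cases hx : x ∈ p.support
  · rw [h x hx]
  · simp [(p.apply_eq_zero_iff x).2 hx]

lemma summable_toReal (p : PMF X) : Summable fun x => (p x).toReal :=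
  ENNReal.summable_toReal p.tsum_coe_ne_top

lemma tsum_toReal (p : PMF X) : ∑' x, (p x).toReal = 1 := by
  rw [← ENNReal.tsum_toReal_eq p.apply_ne_top, p.tsum_coe, ENNReal.toReal_one]

lemma summable_toReal_mul (p : PMF X) {f : X → ℝ} (hf : ∀ x ∈ p.support, f x ∈ Set.Icc 0 1) :
    Summable fun x => (p x).toReal * f x := by
  refine (summable_toReal p).of_norm_bounded fun x => ?_
  by_cases hx : x ∈ p.support
  · obtain ⟨h0, h1⟩ := hf x hx
    rw [Real.norm_of_nonneg (by positivity)]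
    exact mul_le_of_le_one_right ENNReal.toReal_nonneg h1
  · simp [(p.apply_eq_zero_iff x).2 hx]

lemma le_tsum_toReal_mul (p : PMF X) {f : X → ℝ} (hf : ∀ x ∈ p.support, f x ∈ Set.Icc 0 1)
    {c : ℝ} (hc : ∀ x ∈ p.support, c ≤ f x) : c ≤ ∑' x, (p x).toReal * f x := by
  calc c = ∑' x, (p x).toReal * c := by rw [tsum_mul_right, tsum_toReal, one_mul]
    _ ≤ _ := by
      refine ((summable_toReal p).mul_right c).tsum_le_tsum (fun x => ?_)
        (summable_toReal_mul p hf)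
      by_cases hx : x ∈ p.support
      · exact mul_le_mul_of_nonneg_left (hc x hx) ENNReal.toReal_nonneg
      · simp [(p.apply_eq_zero_iff x).2 hx]

lemma tsum_toReal_mul_le_prob (p : PMF X) {f : X → ℝ} (hf : ∀ x ∈ p.support, f x ∈ Set.Icc 0 1)
    {R : Set X} (hR : ∀ x ∈ p.support, x ∉ R → f x = 0) :
    ∑' x, (p x).toReal * f x ≤ prob p R := by
  let _ : MeasurableSpace X := ⊤
  have hp : prob p R = ∑' x, R.indicator (fun x => (p x).toReal) x := by
    have : prob p R = (∑' x, R.indicator p x).toReal :=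
      congrArg ENNReal.toReal (p.toMeasure_apply trivial)
    rw [this, ENNReal.tsum_toReal_eq]
    · refine tsum_congr fun x => ?_
      by_cases hx : x ∈ R <;> simp [hx]
    · intro x
      by_cases hx : x ∈ R <;> simp [hx, p.apply_ne_top]
  rw [hp]
  refine (summable_toReal_mul p hf).tsum_le_tsum (fun x => ?_) ((summable_toReal p).indicator R)
  by_cases hx : x ∈ p.support
  · by_cases hxR : x ∈ R
    · rw [Set.indicator_of_mem hxR]
      exact mul_le_of_le_one_right ENNReal.toReal_nonneg (hf x hx).2
    · rw [Set.indicator_of_notMem hxR, hR x hx hxR, mul_zero]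
  · have : p x = 0 := (p.apply_eq_zero_iff x).2 hx
    by_cases hxR : x ∈ R <;> simp [this, hxR]

end Discrete

/-! ### Laws of play -/

variable {A B : Type}

lemma mem_support_playLaw_succ {π : AliceStrategy A B} {φ : BobStrategy A B} {h h'' : History A B}
    {s : ℕ} (hh : h'' ∈ (playLaw π φ h (s + 1)).support) :
    ∃ h' ∈ (playLaw π φ h s).support, ∃ a ∈ (π h').support, ∃ b ∈ (φ h').support,
      h'' = h' ++ [(a, b)] := by
  simp only [playLaw, PMF.mem_support_bind_iff, PMF.mem_support_map_iff] at hh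
  obtain ⟨h', hh', a, ha, b, hb, rfl⟩ := hh
  exact ⟨h', hh', a, ha, b, hb, rfl⟩

lemma exists_append_of_mem_support {π : AliceStrategy A B} {φ : BobStrategy A B}
    {h : History A B} (s : ℕ) {h' : History A B} (hh : h' ∈ (playLaw π φ h s).support) :
    ∃ r : History A B, h' = h ++ r ∧ r.length = s := by
  induction s generalizing h' with
  | zero => exact ⟨[], by simpa [playLaw] using hh, rfl⟩
  | succ s ih =>
    obtain ⟨h', hh', a, -, b, -, rfl⟩ := mem_support_playLaw_succ hh
    obtain ⟨r, rfl, rfl⟩ := ih hh'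
    exact ⟨r ++ [(a, b)], by simp, by simp⟩

lemma length_of_mem_support {π : AliceStrategy A B} {φ : BobStrategy A B}
    {h h' : History A B} {s : ℕ} (hh : h' ∈ (playLaw π φ h s).support) :
    h'.length = h.length + s := by
  obtain ⟨r, rfl, rfl⟩ := exists_append_of_mem_support s hh
  simp

lemma map_take_playLaw_self (π : AliceStrategy A B) (φ : BobStrategy A B) (s : ℕ) :
    (playLaw π φ [] s).map (List.take s) = playLaw π φ [] s := by
  conv_rhs => rw [← PMF.bind_pure (playLaw π φ [] s)]
  refine bind_congr_support _ fun h hh => ?_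
  have hl : h.length = s := by simpa using length_of_mem_support hh
  simp [← hl]

lemma map_take_playLaw_succ (π : AliceStrategy A B) (φ : BobStrategy A B) (s : ℕ) :
    (playLaw π φ [] (s + 1)).map (List.take s) = playLaw π φ [] s := by
  rw [playLaw, PMF.map_bind]
  conv_rhs => rw [← PMF.bind_pure (playLaw π φ [] s)]
  refine bind_congr_support _ fun h hh => ?_
  have hl : h.length = s := by simpa using length_of_mem_support hh
  have hconst : ∀ a, List.take s ∘ (fun b : B => h ++ [(a, b)]) = Function.const B h := by
    intro a
    funext b
    simp [← hl]
  simp only [PMF.map_bind, PMF.map_comp, hconst, PMF.map_const, PMF.bind_const]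

/-- The laws of play at successive times are consistent: they are the marginals of each other. -/
lemma map_take_playLaw (π : AliceStrategy A B) (φ : BobStrategy A B) {s t : ℕ} (hst : s ≤ t) :
    (playLaw π φ [] t).map (List.take s) = playLaw π φ [] s := by
  induction t, hst using Nat.le_induction with
  | base => exact map_take_playLaw_self π φ s
  | succ t hst ih =>
    rw [← ih, ← map_take_playLaw_succ π φ t, PMF.map_comp]
    congr 1
    funext h
    simp [List.take_take, hst]

/-- As long as a play stays outside a set `R` of histories closed under continuation, its law
depends only on what Bob does outside `R`. -/
lemma playLaw_congr (π : AliceStrategy A B) {φ ψ : BobStrategy A B} {R : Set (History A B)}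
    (hR : ∀ h ∈ R, ∀ x, h ++ [x] ∈ R) (hφ : ∀ h, h ∉ R → φ h = ψ h) (s : ℕ)
    {h₀ h : History A B} (hh : h ∉ R) : playLaw π φ h₀ s h = playLaw π ψ h₀ s h := by
  induction s generalizing h with
  | zero => rfl
  | succ s ih =>
    rw [playLaw, playLaw, PMF.bind_apply, PMF.bind_apply]
    refine tsum_congr fun h' => ?_
    by_cases hh' : h' ∈ R
    · have hzero : ∀ χ : BobStrategy A B,
          ((π h').bind fun a => (χ h').map fun b => h' ++ [(a, b)]) h = 0 := by
        intro χ
        rw [PMF.apply_eq_zero_iff]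
        intro hmem
        simp only [PMF.mem_support_bind_iff, PMF.mem_support_map_iff] at hmem
        obtain ⟨a, -, b, -, rfl⟩ := hmem
        exact hh (hR _ hh' _)
      rw [hzero, hzero, mul_zero, mul_zero]
    · rw [ih hh', hφ h' hh']

/-! ### Bounds on average payoffs -/

section Payoff

variable (G : Game A B) (π : AliceStrategy A B) (φ : BobStrategy A B)

lemma sum_payoff_mem_Icc (r : History A B) :
    (r.map fun p => G.payoff p.1 p.2).sum ∈ Set.Icc (0 : ℝ) r.length := by
  induction r with
  | nil => simp
  | cons x r ih =>
    obtain ⟨h0, h1⟩ := G.payoff_mem x.1 x.2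
    obtain ⟨i0, i1⟩ := ih
    constructor <;> simp <;> linarith

lemma average_mem_Icc {h h' : History A B} {s : ℕ} (hh : h' ∈ (playLaw π φ h s).support) :
    (1 / (s : ℝ)) * totalPayoffAfter G h.length h' ∈ Set.Icc (0 : ℝ) 1 := by
  obtain ⟨r, rfl, rfl⟩ := exists_append_of_mem_support s hh
  obtain ⟨h0, h1⟩ := sum_payoff_mem_Icc G r
  simp only [totalPayoffAfter, List.drop_left]
  rw [one_div_mul_eq_div]
  exact ⟨by positivity, div_le_one_of_le₀ h1 (by positivity)⟩

lemma expectedAverage_nonneg (h : History A B) (s : ℕ) : 0 ≤ expectedAverage G π φ h s :=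
  le_tsum_toReal_mul _ (fun _ => average_mem_Icc G π φ) fun _ hx => (average_mem_Icc G π φ hx).1

lemma expectedAverage_le_one (h : History A B) (s : ℕ) : expectedAverage G π φ h s ≤ 1 :=
  (tsum_toReal_mul_le_prob _ (fun _ => average_mem_Icc G π φ)
    (R := Set.univ) fun _ _ hx => (hx trivial).elim).trans (prob_le_one _ _)

lemma value_le_of_forall_le {h : History A B} {c : ℝ}
    (hc : ∀ s, expectedAverage G π φ h s ≤ c) : value G π φ h ≤ c := by
  refine liminf_le_of_frequently_le (Frequently.of_forall hc) ?_
  exact isBoundedUnder_of ⟨0, expectedAverage_nonneg G π φ h⟩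

end Payoff

/-! ### Streaks of an action -/

/-- The histories in which Alice plays `a` at all positions `i` with `n ≤ i < T`, positions being
counted from `0`. They have length at least `T` if `n < T`. -/
def streak (a : A) (n T : ℕ) : Set (History A B) :=
  {h | ∀ i, n ≤ i → i < T → h[i]?.map Prod.fst = some a}

lemma streak_subset (a : A) {n m T L : ℕ} (hn : n ≤ m) (hT : T ≤ L) :
    (streak a n L : Set (History A B)) ⊆ streak a m T :=
  fun _ hh i hi hiT => hh i (hn.trans hi) (hiT.trans_le hT)

lemma append_mem_streak {a : A} {n T : ℕ} {h : History A B} (hh : h ∈ streak a n T)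
    (r : History A B) : h ++ r ∈ streak a n T := by
  intro i hi hiT
  have := hh i hi hiT
  have hil : i < h.length := by
    by_contra hcon
    rw [List.getElem?_eq_none (not_lt.1 hcon)] at this
    simp at this
  rwa [List.getElem?_append_left hil]

lemma prob_streak_eq (π : AliceStrategy A B) (φ : BobStrategy A B) (a : A) (n : ℕ) {T L : ℕ}
    (hTL : T ≤ L) :
    prob (playLaw π φ [] L) (streak a n T) = prob (playLaw π φ [] T) (streak a n T) := by
  rw [← map_take_playLaw π φ hTL, prob_map]
  congr 1
  ext h
  refine forall₃_congr fun i _ hiT => ?_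
  rw [List.getElem?_take_of_lt hiT]

lemma prob_streak_anti (π : AliceStrategy A B) (φ : BobStrategy A B) (a : A) (n : ℕ) {T L : ℕ}
    (hTL : T ≤ L) :
    prob (playLaw π φ [] L) (streak a n L) ≤ prob (playLaw π φ [] T) (streak a n T) := by
  rw [← prob_streak_eq π φ a n hTL]
  exact prob_mono _ fun _ _ hx => streak_subset a le_rfl hTL hx

/-- Some action is unlikely to be the one Alice eventually sticks to. -/
lemma exists_action_streak_le [Fintype A] [Nonempty A] (π : AliceStrategy A B)
    (φ : BobStrategy A B) :
    ∃ a : A, ∀ n, ∃ L₀, ∀ L ≥ L₀,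
      prob (playLaw π φ [] L) (streak a n L) ≤ 1 / Fintype.card A := by
  by_contra! hcon
  choose m hm using hcon
  -- From the stage `M` on, every action has a streak of probability above `1 / |A|`; already at
  -- the single position `M` these events are disjoint.
  obtain ⟨M, hM⟩ := (Set.finite_range m).bddAbove
  have hmM : ∀ a, m a ≤ M := fun a => hM ⟨a, rfl⟩
  have hlt : ∀ a, 1 / (Fintype.card A : ℝ) <
      prob (playLaw π φ [] (M + 1)) (streak a M (M + 1)) := by
    intro a
    obtain ⟨L, hL, h⟩ := hm a (M + 1)
    refine h.trans_le ((prob_streak_anti π φ a _ hL).trans ?_)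
    exact prob_mono _ fun _ _ hx => streak_subset a (hmM a) le_rfl hx
  have hsum : ∑ a, prob (playLaw π φ [] (M + 1)) (streak a M (M + 1)) ≤ 1 := by
    refine sum_prob_le_one _ _ fun a b hab => Set.disjoint_left.2 fun h ha hb => hab ?_
    exact Option.some.inj ((ha M le_rfl M.lt_succ_self).symm.trans (hb M le_rfl M.lt_succ_self))
  have := Finset.sum_lt_sum_of_nonempty Finset.univ_nonempty fun a _ => hlt a
  have hcard : (Fintype.card A : ℝ) ≠ 0 := by positivity
  rw [Finset.sum_const, Finset.card_univ, nsmul_eq_mul, mul_one_div_cancel hcard] at this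
  exact absurd hsum (not_le.2 this)

/-- The deadlines `T`: a streak that lasts from `n` to `T n` lasts up to any later time, except
with a probability that is small and summable in `n`. -/
lemma exists_deadlines (π : AliceStrategy A B) (φ : BobStrategy A B) (a : A) {ε : ℕ → ℝ}
    (hε : ∀ n, 0 < ε n) :
    ∃ T : ℕ → ℕ, (∀ n, n < T n) ∧ ∀ n L, T n ≤ L →
      prob (playLaw π φ [] (T n)) (streak a n (T n)) ≤
        prob (playLaw π φ [] L) (streak a n L) + ε n := by
  have key : ∀ n, ∃ T, n < T ∧ ∀ L, T ≤ L →
      prob (playLaw π φ [] T) (streak a n T) ≤ prob (playLaw π φ [] L) (streak a n L) + ε n := by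
    intro n
    have hbdd : BddBelow (Set.range fun L => prob (playLaw π φ [] L) (streak a n L)) :=
      ⟨0, by rintro _ ⟨L, rfl⟩; exact prob_nonneg _ _⟩
    obtain ⟨T, hT⟩ := exists_lt_of_ciInf_lt
      (lt_add_of_pos_right (⨅ L, prob (playLaw π φ [] L) (streak a n L)) (hε n))
    refine ⟨max T (n + 1), by omega, fun L _ => ?_⟩
    have h1 := prob_streak_anti π φ a n (le_max_left T (n + 1))
    have h2 := ciInf_le hbdd L
    linarith
  choose T hT using key
  exact ⟨T, fun n => (hT n).1, fun n => (hT n).2⟩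

/-! ### The rewarding opponent -/

/-- The histories in which Alice has completed one of the streaks of `a` on a window
`[n, T n)`. -/
def rewarded (a : A) (T : ℕ → ℕ) : Set (History A B) := ⋃ n, streak a n (T n)

lemma append_mem_rewarded {a : A} {T : ℕ → ℕ} {h : History A B} (hh : h ∈ rewarded a T)
    (r : History A B) : h ++ r ∈ rewarded a T := by
  obtain ⟨n, hn⟩ := Set.mem_iUnion.1 hh
  exact Set.mem_iUnion.2 ⟨n, append_mem_streak hn r⟩

open Classical in
/-- Bob's strategy: play `b₁` once Alice has earned the reward, and `b₀` before. -/
noncomputable def rewardingBob (a : A) (b₀ b₁ : B) (T : ℕ → ℕ) : BobStrategy A B :=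
  fun h => if h ∈ rewarded a T then PMF.pure b₁ else PMF.pure b₀

/-- Alice's strategy of playing `a` in all stages. -/
noncomputable def constExpert (a : A) : AliceStrategy A B := fun _ => PMF.pure a

/-- Against the passive Bob, Alice is unlikely ever to earn the reward. -/
lemma prob_rewarded_le (π : AliceStrategy A B) (φ : BobStrategy A B) {a : A} {c ε : ℝ}
    (hε : 0 < ε)
    (ha : ∀ n, ∃ L₀, ∀ L ≥ L₀, prob (playLaw π φ [] L) (streak a n L) ≤ c)
    {T : ℕ → ℕ} (hT : ∀ n, n < T n)
    (hTL : ∀ n L, T n ≤ L → prob (playLaw π φ [] (T n)) (streak a n (T n)) ≤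
        prob (playLaw π φ [] L) (streak a n L) + ε / 2 / 2 ^ n) (s : ℕ) :
    prob (playLaw π φ [] s) (rewarded a T) ≤ c + ε := by
  obtain ⟨L₀, hL₀⟩ := ha s
  set L := max (max L₀ s) ((Finset.range s).sup T) with hL
  have hsL : s ≤ L := by omega
  have hTn : ∀ n ∈ Finset.range s, T n ≤ L := fun n hn =>
    (Finset.le_sup hn).trans (le_max_right _ _)
  -- A window completed within `s` stages starts before `s`. So at the time `L` either Alice has
  -- been playing `a` since the stage `s` at the latest, or a completed streak has been broken.
  calc prob (playLaw π φ [] s) (rewarded a T)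
      ≤ prob (playLaw π φ [] L) (⋃ n ∈ Finset.range s, streak a n (T n)) := by
        rw [← map_take_playLaw π φ hsL, prob_map]
        refine prob_mono _ fun h _ hh => ?_
        obtain ⟨n, hn⟩ := Set.mem_iUnion.1 hh
        have hns : n < s := by
          have := hn n le_rfl (hT n)
          by_contra hcon
          rw [List.getElem?_eq_none (by simp; omega)] at this
          simp at this
        refine Set.mem_biUnion (Finset.mem_coe.2 (Finset.mem_range.2 hns)) ?_
        rw [← List.take_append_drop s h]
        exact append_mem_streak hn _
    _ ≤ prob (playLaw π φ [] L) (streak a s L) + ∑ n ∈ Finset.range s, ε / 2 / 2 ^ n := by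
        refine prob_le_add_sum (F' := fun n => streak a n L) _ _ ?_
          (fun n hn => streak_subset a le_rfl (hTn n hn)) fun n hn => ?_
        · intro h hh
          simp only [Set.mem_iUnion] at hh
          obtain ⟨n, hns, hn⟩ := hh
          by_cases hF : h ∈ streak a n L
          · exact Or.inl (streak_subset a (Finset.mem_range.1 hns).le le_rfl hF)
          · exact Or.inr (Set.mem_biUnion hns ⟨hn, hF⟩)
        · rw [prob_streak_eq π φ a n (hTn n hn)]
          exact hTL n L (hTn n hn)
    _ ≤ c + ε := by
        refine add_le_add (hL₀ L (by omega)) ?_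
        exact ((summable_geometric_two' ε).sum_le_tsum _ fun n _ => by positivity).trans_eq
          (tsum_geometric_two' ε)

section Rewarding

variable (G : Game A B) {b₀ b₁ : B}

/-- The expert who always plays the action singled out by Bob has value `1` after every history. -/
lemma value_constExpert (hb₁ : ∀ a, G.payoff a b₁ = 1) (a : A) (T : ℕ → ℕ) (h : History A B) :
    value G (constExpert a) (rewardingBob a b₀ b₁ T) h = 1 := by
  -- The window starting right after `h` is completed at the stage `T h.length`, and all later
  -- stages pay `1`.
  have key : ∀ s h', h' ∈ (playLaw (constExpert a) (rewardingBob a b₀ b₁ T) h s).support →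
      ∃ r : History A B, h' = h ++ r ∧ r.length = s ∧ (∀ x ∈ r, x.1 = a) ∧
        (s : ℝ) - T h.length ≤ (r.map fun p => G.payoff p.1 p.2).sum := by
    intro s
    induction s with
    | zero =>
      intro h' hh
      exact ⟨[], by simpa [playLaw] using hh, rfl, by simp, by simp⟩
    | succ s ih =>
      intro h'' hh
      obtain ⟨h', hh', a', ha', b, hb, rfl⟩ := mem_support_playLaw_succ hh
      obtain ⟨r, rfl, hr, hra, hsum⟩ := ih h' hh'
      obtain rfl : a' = a := by simpa [constExpert] using ha'
      refine ⟨r ++ [(a', b)], by simp, by simp [hr], ?_, ?_⟩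
      · intro x hx
        rcases List.mem_append.1 hx with hx | hx
        · exact hra x hx
        · rw [List.mem_singleton.1 hx]
      · simp only [List.map_append, List.sum_append, List.map_cons, List.map_nil, List.sum_cons,
          List.sum_nil, add_zero]
        push_cast
        by_cases hs : T h.length ≤ s
        · have hrew : h ++ r ∈ rewarded a' T := by
            refine Set.mem_iUnion.2 ⟨h.length, fun i hi hiT => ?_⟩
            rw [List.getElem?_append_right hi, List.getElem?_eq_getElem (by omega)]
            simp [hra _ (List.getElem_mem _)]
          obtain rfl : b = b₁ := by simpa [rewardingBob, hrew] using hb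
          rw [hb₁]
          linarith
        · have h0 := (sum_payoff_mem_Icc G r).1
          have h1 := (G.payoff_mem a' b).1
          have : (s : ℝ) + 1 ≤ T h.length := by exact_mod_cast not_le.1 hs
          linarith
  have hlim : Tendsto (fun s : ℕ => 1 - (T h.length : ℝ) / s) atTop (𝓝 1) := by
    simpa using tendsto_const_nhds.sub (tendsto_const_div_atTop_nhds_zero_nat (T h.length : ℝ))
  refine (tendsto_of_tendsto_of_tendsto_of_le_of_le' hlim tendsto_const_nhds ?_
    (Eventually.of_forall (expectedAverage_le_one G _ _ h))).liminf_eq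
  filter_upwards [eventually_gt_atTop 0] with s hs
  refine le_tsum_toReal_mul _ (fun _ => average_mem_Icc G _ _) fun h' hh' => ?_
  obtain ⟨r, rfl, -, -, hsum⟩ := key s h' hh'
  have hs' : (0 : ℝ) < s := by exact_mod_cast hs
  rw [totalPayoffAfter, List.drop_left, one_div_mul_eq_div, le_div_iff₀ hs', sub_mul,
    div_mul_cancel₀ _ hs'.ne', one_mul]
  exact hsum

/-- Alice's average payoff against the rewarding Bob is at most the probability of earning the
reward, and this probability is the same as against the passive Bob. -/
lemma expectedAverage_rewardingBob_le (hb₀ : ∀ a, G.payoff a b₀ = 0) (π : AliceStrategy A B)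
    (a : A) (T : ℕ → ℕ) (s : ℕ) :
    expectedAverage G π (rewardingBob a b₀ b₁ T) [] s ≤
      prob (playLaw π (fun _ => PMF.pure b₀) [] s) (rewarded a T) := by
  have hlaw : prob (playLaw π (fun _ => PMF.pure b₀) [] s) (rewarded a T) =
      prob (playLaw π (rewardingBob a b₀ b₁ T) [] s) (rewarded a T) := by
    refine prob_congr_compl fun h hh => (playLaw_congr π ?_ ?_ s hh).symm
    · exact fun h hh x => append_mem_rewarded hh [x]
    · exact fun h hh => if_neg hh
  have hzero : ∀ s, ∀ h ∈ (playLaw π (rewardingBob a b₀ b₁ T) [] s).support,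
      h ∉ rewarded a T → (h.map fun p => G.payoff p.1 p.2).sum = 0 := by
    intro s
    induction s with
    | zero =>
      intro h hh _
      obtain rfl : h = [] := by simpa [playLaw] using hh
      rfl
    | succ s ih =>
      intro h hh hrew
      obtain ⟨h', hh', a', -, b, hb, rfl⟩ := mem_support_playLaw_succ hh
      have hrew' : h' ∉ rewarded a T := fun hcon => hrew (append_mem_rewarded hcon _)
      obtain rfl : b = b₀ := by simpa [rewardingBob, hrew'] using hb
      simp [ih h' hh' hrew', hb₀]
  rw [hlaw]
  refine tsum_toReal_mul_le_prob _ (fun _ => average_mem_Icc G _ _) fun h hh hrew => ?_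
  simp [totalPayoffAfter, hzero s h hh hrew]

/-- If Bob can give Alice the payoffs `0` and `1` at will and all constant strategies are among
the experts, then every strategy of Alice has open-ended regret at least `1 - 1 / |A| - ε` against
some opponent. -/
theorem exists_openEndedRegret_ge [Fintype A] [Nonempty A] (hb₀ : ∀ a, G.payoff a b₀ = 0)
    (hb₁ : ∀ a, G.payoff a b₁ = 1) {E : Finset (AliceStrategy A B)} (hE : E.Nonempty)
    (hEc : ∀ a, constExpert a ∈ E) (π : AliceStrategy A B) {ε : ℝ} (hε : 0 < ε) :
    ∃ φ : BobStrategy A B,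
      1 - 1 / (Fintype.card A : ℝ) - ε ≤ openEndedRegret G E hE π φ := by
  let passive : BobStrategy A B := fun _ => PMF.pure b₀
  obtain ⟨a, ha⟩ := exists_action_streak_le π passive
  obtain ⟨T, hT, hTL⟩ := exists_deadlines π passive a
    (ε := fun n => ε / 2 / 2 ^ n) fun n => by positivity
  refine ⟨rewardingBob a b₀ b₁ T, ?_⟩
  have hexp : 1 ≤ E.sup' hE fun e => ⨅ h, value G e (rewardingBob a b₀ b₁ T) h := by
    refine le_trans ?_ (Finset.le_sup' _ (hEc a))
    simp only [value_constExpert G hb₁ a T, ciInf_const, le_refl]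
  have hval : value G π (rewardingBob a b₀ b₁ T) [] ≤ 1 / (Fintype.card A : ℝ) + ε :=
    value_le_of_forall_le _ _ _ fun s => (expectedAverage_rewardingBob_le G hb₀ π a T s).trans
      (prob_rewarded_le π passive hε ha hT hTL s)
  unfold openEndedRegret
  linarith

end Rewarding

/-- The game in which Bob's action `b₀` pays `0` to Alice and all his other actions pay `1`. -/
noncomputable def bobControlledGame [DecidableEq B] (b₀ : B) : Game A B where
  payoff _ b := if b = b₀ then 0 else 1
  payoff_mem _ b := by split_ifs <;> simp

end RepeatedGame

theorem corollary1 (N : ℕ) (hN : 3 ≤ N) :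
    ∃ (G : RepeatedGame.Game (Fin N) (Fin N))
      (E : Finset (RepeatedGame.AliceStrategy (Fin N) (Fin N))) (hE : E.Nonempty),
      ∀ (alg : RepeatedGame.LearningAlgorithm (Fin N) (Fin N)) (δ : ℝ),
        0 < δ → δ < ((N : ℝ) - 2) / (N : ℝ) →
        ∃ φ : RepeatedGame.BobStrategy (Fin N) (Fin N),
          (1 / 2 : ℝ) * (((N : ℝ) - 2) / (N : ℝ) - δ) ^ 2 ≤
            RepeatedGame.openEndedRegret G E hE (alg G E) φ := by
  classical
  let b₀ : Fin N := ⟨0, by omega⟩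
  let b₁ : Fin N := ⟨1, by omega⟩
  have hb : b₁ ≠ b₀ := by simp [b₀, b₁]
  have : Nonempty (Fin N) := ⟨b₀⟩
  refine ⟨RepeatedGame.bobControlledGame b₀, Finset.univ.image RepeatedGame.constExpert,
    Finset.univ_nonempty.image _, fun alg δ hδ hδN => ?_⟩
  obtain ⟨φ, hφ⟩ := RepeatedGame.exists_openEndedRegret_ge
    (RepeatedGame.bobControlledGame b₀) (b₀ := b₀) (b₁ := b₁)
    (fun _ => by simp [RepeatedGame.bobControlledGame])
    (fun _ => by simp [RepeatedGame.bobControlledGame, hb]) (Finset.univ_nonempty.image _)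
    (fun a => Finset.mem_image_of_mem _ (Finset.mem_univ a))
    (alg (RepeatedGame.bobControlledGame b₀) (Finset.univ.image RepeatedGame.constExpert)) hδ
  refine ⟨φ, le_trans ?_ hφ⟩
  have hN0 : (0 : ℝ) < N := by
    have : 0 < N := by omega
    exact_mod_cast this
  have hdiv : ((N : ℝ) - 2) / N = 1 - 2 * (1 / N) := by field_simp
  have hinv : (0 : ℝ) < 1 / N := by positivity
  rw [Fintype.card_fin]
  rw [hdiv] at hδN ⊢
  nlinarith
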